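/- There exist absolute constants $c>0$ and $p>0$ such that for every $M>0$ there is a constant $C=C(M)>0$ with the following property. Let $A\subset\mathbb{R}$ be a finite set with $|A|\ge 2$ and $|A/A|\le M|A|$, where $A/A=\{a/b : a,b\in A,\ b\neq 0\}$. Then the fourfold sumset $4A=A+A+A+A=\{a_1+a_2+a_3+a_4 : a_1,\dots,a_4\in A\}$ satisfies $$|A|^{2+c}\le C\,|4A|\,(\log_2|A|)^{p}.$$ -/

import Mathlib

open scoped Pointwise

/-- The quotient set `A/B = {a/b : a ∈ A, b ∈ B, b ≠ 0}` of finite sets of reals. -/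
noncomputable def quotientSet (A B : Finset ℝ) : Finset ℝ :=
  Finset.image₂ (fun a b => a / b) A (B.filter (fun b => b ≠ 0))

namespace SumsetGrowth

open Finset

/-! Write N = |A|. After passing to positive elements P, Plünnecke–Ruzsa makes W = P·(P/P) have size
O(N). Cutting the line after every L elements of W splits P into O(N/L) blocks, and two elements of
one block have a ratio from a fixed set of O(L) numbers (`exists_isBlocking`). In a coincidence
a+b+⋯ = a'+b'+⋯, prescribing the differences of block indices on both sides costs a factor N/L per
difference. Then all indices must agree, since otherwise every term would move in the same
direction. So a' = (1+δ)a and so on, with δa + εb + ⋯ = 0 and few possible coefficients. For two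
summands, b is determined by a, δ, ε, and L = N^{1/2} gives additive energy O(N^{5/2}). For four,
Cauchy–Schwarz bounds each linear relation by that energy, and L = N^{3/8} gives O(N^{47/8})
coincidences. Hence |4A| ≫ N^{8-47/8} = N^{2+1/8}, with no logarithm needed. -/

/-! ### Coincidence counts and Cauchy–Schwarz -/

/-- The number of coincidences `f x = f y` with `x, y ∈ X`. -/
noncomputable def coincidences {α β : Type*} (X : Finset α) (f : α → β) : ℕ := by
  classical exact #{p ∈ X ×ˢ X | f p.1 = f p.2}

open Classical in
lemma card_filter_eq_eq_sum {α α' β : Type*} (X : Finset α) (Y : Finset α') (f : α → β)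
    (g : α' → β) (Z : Finset β) (hZ : ∀ x ∈ X, f x ∈ Z) :
    #{p ∈ X ×ˢ Y | f p.1 = g p.2} = ∑ z ∈ Z, #{x ∈ X | f x = z} * #{y ∈ Y | g y = z} := by
  rw [card_eq_sum_card_fiberwise (f := fun p => f p.1) (t := Z)]
  · refine sum_congr rfl fun z _ => ?_
    rw [← card_product]
    congr 1
    ext ⟨x, y⟩
    simp only [mem_filter, mem_product]
    grind
  · intro p hp
    simp only [coe_filter, mem_product, Set.mem_ofPred_eq] at hp
    exact hZ _ hp.1.1

open Classical in
lemma coincidences_eq_sum {α β : Type*} (X : Finset α) (f : α → β) (Z : Finset β)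
    (hZ : ∀ x ∈ X, f x ∈ Z) : coincidences X f = ∑ z ∈ Z, #{x ∈ X | f x = z} ^ 2 := by
  simp only [coincidences, sq]
  exact card_filter_eq_eq_sum X X f f Z hZ

open Classical in
/-- Cauchy–Schwarz for the number of solutions of `f x = g y`. -/
lemma card_filter_eq_sq_le {α α' β : Type*} (X : Finset α) (Y : Finset α') (f : α → β)
    (g : α' → β) :
    #{p ∈ X ×ˢ Y | f p.1 = g p.2} ^ 2 ≤ coincidences X f * coincidences Y g := by
  have hX : ∀ x ∈ X, f x ∈ X.image f ∪ Y.image g := fun x hx =>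
    mem_union_left _ (mem_image_of_mem _ hx)
  have hY : ∀ y ∈ Y, g y ∈ X.image f ∪ Y.image g := fun y hy =>
    mem_union_right _ (mem_image_of_mem _ hy)
  rw [card_filter_eq_eq_sum X Y f g _ hX, coincidences_eq_sum X f _ hX,
    coincidences_eq_sum Y g _ hY]
  exact sum_mul_sq_le_sq_mul_sq _ _ _

/-- Cauchy–Schwarz: a map with few values has many coincidences. -/
lemma card_sq_le_mul_coincidences {α β : Type*} (X : Finset α) (f : α → β) (Z : Finset β)
    (hZ : ∀ x ∈ X, f x ∈ Z) : #X ^ 2 ≤ #Z * coincidences X f := by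
  classical
  rw [coincidences_eq_sum X f Z hZ, card_eq_sum_card_fiberwise (f := f) (t := Z) hZ]
  exact sq_sum_le_card_mul_sum_sq

/-- Refining a map by a key with few values loses at most the number of keys. -/
lemma coincidences_le_mul_coincidences_prod {α β γ : Type*} (X : Finset α) (f : α → β)
    (k : α → γ) (Z : Finset γ) (hZ : ∀ x ∈ X, k x ∈ Z) :
    coincidences X f ≤ #Z * coincidences X (fun x => (f x, k x)) := by
  classical
  rw [coincidences_eq_sum X f (X.image f) fun x hx => mem_image_of_mem _ hx,
    coincidences_eq_sum X (fun x => (f x, k x)) (X.image f ×ˢ Z)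
      fun x hx => mem_product.2 ⟨mem_image_of_mem _ hx, hZ x hx⟩, sum_product, mul_sum]
  refine sum_le_sum fun z _ => ?_
  have h := card_sq_le_mul_coincidences {x ∈ X | f x = z} k Z
    fun x hx => hZ x (mem_filter.1 hx).1
  rw [coincidences_eq_sum _ k Z fun x hx => hZ x (mem_filter.1 hx).1] at h
  simpa only [filter_filter, Prod.mk.injEq] using h

/-! ### Blocks with few internal ratios -/

/-- A partition of `P` into intervals, indexed by a monotone `β` with values at most `m`, such that
elements of the same interval differ by a multiple from the set `D`. -/
structure IsBlocking (P : Finset ℝ) (m : ℕ) (β : ℝ → ℕ) (D : Finset ℝ) : Prop where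
  mono : Monotone β
  le : ∀ a ∈ P, β a ≤ m
  zero_notMem : (0 : ℝ) ∉ D
  diff : ∀ a ∈ P, ∀ a' ∈ P, β a = β a' → a ≠ a' → ∃ δ ∈ D, a' - a = δ * a

-- If a < b share a block, every p in P/P with 1 < p ≤ b/a gives a point ap of P·(P/P) in (a, b],
-- and there are fewer than L such points. So b/a is among the first elements of P/P above 1.
open scoped Pointwise in
lemma exists_isBlocking (P : Finset ℝ) (hP : ∀ a ∈ P, 0 < a) (L : ℕ) (hL : 0 < L) :
    ∃ β D, #D ≤ 2 * L ∧ IsBlocking P (#(P * (P / P)) / L) β D := by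
  classical
  set Q := P / P with hQ
  set W := P * Q with hW
  set H := {q ∈ Q | 1 < q ∧ #{p ∈ Q | 1 < p ∧ p ≤ q} < L} with hH
  have hHL : #H ≤ L := by
    rcases H.eq_empty_or_nonempty with h | h
    · simp [h]
    · have hm := H.max'_mem h
      set q := H.max' h with hq
      have hm' := (mem_filter.1 hm).2.2
      refine le_trans (card_le_card fun p hp => ?_) hm'.le
      have hp' := mem_filter.1 hp
      exact mem_filter.2 ⟨hp'.1, hp'.2.1, H.le_max' p hp⟩
  have hmonoR : Monotone fun a : ℝ => #{w ∈ W | w ≤ a} := fun a b hab =>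
    card_le_card fun w hw => by
      simp only [mem_filter] at hw ⊢
      exact ⟨hw.1, hw.2.trans hab⟩
  have key : ∀ a ∈ P, ∀ b ∈ P, a < b → #{w ∈ W | w ≤ a} / L = #{w ∈ W | w ≤ b} / L →
      b / a ∈ H := by
    intro a ha b hb hab h
    have ha0 := hP a ha
    refine mem_filter.2 ⟨div_mem_div hb ha, (one_lt_div ha0).2 hab, ?_⟩
    have h1 : #{p ∈ Q | 1 < p ∧ p ≤ b / a} ≤ #{w ∈ W | a < w ∧ w ≤ b} := by
      refine card_le_card_of_injOn (fun p => a * p) (fun p hp => ?_)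
        (fun p _ q _ hpq => mul_left_cancel₀ ha0.ne' hpq)
      simp only [coe_filter, Set.mem_ofPred_eq] at hp ⊢
      refine ⟨mul_mem_mul ha hp.1, lt_mul_of_one_lt_right ha0 hp.2.1, ?_⟩
      have := (le_div_iff₀ ha0).1 hp.2.2
      linarith
    have h2 : #{w ∈ W | w ≤ a} + #{w ∈ W | a < w ∧ w ≤ b} ≤ #{w ∈ W | w ≤ b} := by
      rw [← card_union_of_disjoint]
      · refine card_le_card fun w hw => ?_
        simp only [mem_union, mem_filter] at hw ⊢
        rcases hw with hw | hw
        · exact ⟨hw.1, hw.2.trans hab.le⟩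
        · exact ⟨hw.1, hw.2.2⟩
      · refine disjoint_left.2 fun w hw hw' => ?_
        simp only [mem_filter] at hw hw'
        linarith [hw.2, hw'.2.1]
    have h3 := Nat.div_add_mod #{w ∈ W | w ≤ a} L
    have h4 := Nat.div_add_mod #{w ∈ W | w ≤ b} L
    have h5 := Nat.mod_lt #{w ∈ W | w ≤ b} hL
    rw [← h] at h4
    omega
  refine ⟨fun a => #{w ∈ W | w ≤ a} / L,
    -- The two images serve a < a' and a > a' respectively.
    H.image (fun h => h - 1) ∪ H.image (fun h => h⁻¹ - 1), ?_, ?_, ?_, ?_, ?_⟩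
  · refine (card_union_le _ _).trans ?_
    have h1 := card_image_le (s := H) (f := fun h => h - 1)
    have h2 := card_image_le (s := H) (f := fun h => h⁻¹ - 1)
    omega
  · exact fun a b hab => Nat.div_le_div_right (hmonoR hab)
  · exact fun a _ => Nat.div_le_div_right (card_le_card (filter_subset _ _))
  · intro h
    simp only [mem_union, mem_image] at h
    rcases h with ⟨q, hq, h⟩ | ⟨q, hq, h⟩
    · linarith [(mem_filter.1 hq).2.1]
    · have : q = 1 := inv_eq_one.1 (by linarith)
      linarith [(mem_filter.1 hq).2.1]
  · intro a ha b hb h hne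
    have ha0 := hP a ha
    have hb0 := hP b hb
    rcases lt_or_gt_of_ne hne with hab | hab
    · refine ⟨_, mem_union_left _ (mem_image_of_mem _ (key a ha b hb hab h)), ?_⟩
      field_simp
    · refine ⟨_, mem_union_right _ (mem_image_of_mem _ (key b hb a ha hab h.symm)), ?_⟩
      field_simp

/-! ### Additive energy of two summands -/

lemma card_Icc_neg (m : ℕ) : #(Icc (-(m : ℤ)) m) = 2 * m + 1 := by
  rw [Int.card_Icc]
  omega

lemma coincidences_add_le_of_isBlocking {P : Finset ℝ} {m : ℕ} {β : ℝ → ℕ} {D : Finset ℝ}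
    (h : IsBlocking P m β D) :
    coincidences (P ×ˢ P) (fun p => p.1 + p.2) ≤ (2 * m + 1) * (#P ^ 2 + #P * #D ^ 2) := by
  classical
  refine (coincidences_le_mul_coincidences_prod _ _ (fun p => (β p.1 : ℤ) - β p.2)
    (Icc (-(m : ℤ)) m) fun p hp => ?_).trans ?_
  · have h1 := h.le _ (mem_product.1 hp).1
    have h2 := h.le _ (mem_product.1 hp).2
    rw [mem_Icc]
    omega
  · rw [card_Icc_neg]
    gcongr
    have hsub : {p ∈ (P ×ˢ P) ×ˢ (P ×ˢ P) | (p.1.1 + p.1.2, (β p.1.1 : ℤ) - β p.1.2) =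
        (p.2.1 + p.2.2, (β p.2.1 : ℤ) - β p.2.2)} ⊆
        (P ×ˢ P).image (fun p => (p, p)) ∪ (P ×ˢ (D ×ˢ D)).image (fun t =>
          ((t.1, -(t.2.1 * t.1) / t.2.2), (t.1 + t.2.1 * t.1,
            -(t.2.1 * t.1) / t.2.2 + t.2.2 * (-(t.2.1 * t.1) / t.2.2)))) := by
      rintro ⟨⟨a, b⟩, ⟨a', b'⟩⟩ hp
      simp only [mem_filter, mem_product, Prod.mk.injEq] at hp
      obtain ⟨⟨⟨ha, hb⟩, ha', hb'⟩, hs, hk⟩ := hp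
      -- Equal index differences would make a and b both increase or both decrease, contradicting
      -- equal sums.
      have hab : β a = β a' := by
        rcases lt_trichotomy (β a) (β a') with hlt | heq | hgt
        · have h1 := h.mono.reflect_lt hlt
          have h2 := h.mono.reflect_lt (a := b) (b := b') (by omega)
          linarith
        · exact heq
        · have h1 := h.mono.reflect_lt hgt
          have h2 := h.mono.reflect_lt (a := b') (b := b) (by omega)
          linarith
      have hbb : β b = β b' := by omega
      by_cases hne : a = a'
      · subst hne
        have : b = b' := by linarith
        subst this
        exact mem_union_left _ (mem_image.2 ⟨(a, b), by simp [ha, hb], rfl⟩)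
      · have hne' : b ≠ b' := fun h => hne (by linarith)
        obtain ⟨δ, hδ, hδa⟩ := h.diff a ha a' ha' hab hne
        obtain ⟨ε, hε, hεb⟩ := h.diff b hb b' hb' hbb hne'
        have hε0 : ε ≠ 0 := fun h0 => h.zero_notMem (h0 ▸ hε)
        have hb_eq : -(δ * a) / ε = b := by
          rw [div_eq_iff hε0]
          linarith
        refine mem_union_right _ (mem_image.2 ⟨(a, δ, ε), by simp [ha, hδ, hε], ?_⟩)
        simp only [hb_eq, Prod.mk.injEq, true_and]
        constructor <;> linarith
    unfold coincidences
    refine (le_of_eq_of_le (by congr) (card_le_card hsub)).trans ((card_union_le _ _).trans ?_)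
    refine (add_le_add card_image_le card_image_le).trans (le_of_eq ?_)
    simp only [card_product]
    ring

/-! ### Linear relations and fourfold coincidences -/

/-- The weight attached to a pair of coefficients, according to how many of them vanish. -/
noncomputable def coeffWeight (G n : ℕ) (δ ε : ℝ) : ℕ := by
  classical exact if δ = 0 then (if ε = 0 then n ^ 16 else n ^ 12)
    else if ε = 0 then n ^ 12 else G

/-- For nonzero coefficients, rewrite the coincidence as δ(a−c) = ε(d−b) and apply Cauchy–Schwarz:
dilation is harmless, and difference coincidences rearrange into sum coincidences. A vanishing
coefficient leaves its variable free. -/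
lemma coincidences_linear_le (P : Finset ℝ) (G n : ℕ) (hn : #P ≤ n ^ 8)
    (hG : coincidences (P ×ˢ P) (fun p => p.1 + p.2) ≤ G ^ 2) (δ ε : ℝ) :
    coincidences (P ×ˢ P) (fun p => δ * p.1 + ε * p.2) ≤ coeffWeight G n δ ε ^ 2 := by
  classical
  have hcomm : ∀ lam : ℝ, lam ≠ 0 →
      coincidences (P ×ˢ P) (fun p => lam * p.1 - lam * p.2) ≤ G ^ 2 := by
    intro lam hlam
    refine le_trans ?_ hG
    refine card_le_card_of_injOn
      (fun p : (ℝ × ℝ) × (ℝ × ℝ) => ((p.1.1, p.2.2), (p.2.1, p.1.2))) ?_ ?_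
    · rintro ⟨⟨a, b⟩, ⟨c, d⟩⟩ hp
      simp only [coe_filter, mem_product, Set.mem_ofPred_eq] at hp ⊢
      refine ⟨by tauto, mul_left_cancel₀ hlam ?_⟩
      linarith [hp.2]
    · rintro ⟨⟨a, b⟩, ⟨c, d⟩⟩ _ ⟨⟨a', b'⟩, ⟨c', d'⟩⟩ _ hp
      simp only [Prod.mk.injEq] at hp ⊢
      tauto
  have hone : ∀ lam : ℝ, lam ≠ 0 →
      #{p ∈ P ×ˢ P | lam * p.1 = lam * p.2} ≤ n ^ 8 := by
    intro lam hlam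
    refine le_trans (card_le_card_of_injOn (t := P) Prod.fst ?_ ?_) hn
    · intro p hp
      simp only [coe_filter, mem_product, Set.mem_ofPred_eq] at hp
      exact hp.1.1
    · rintro ⟨a, b⟩ hp ⟨c, d⟩ hq hpq
      simp only [coe_filter, mem_product, Set.mem_ofPred_eq] at hp hq hpq
      have h1 := mul_left_cancel₀ hlam hp.2
      have h2 := mul_left_cancel₀ hlam hq.2
      subst h1 h2 hpq
      rfl
  have htwo : #(P ×ˢ P) ≤ n ^ 16 := by
    rw [card_product]
    calc #P * #P ≤ n ^ 8 * n ^ 8 := by gcongr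
      _ = n ^ 16 := by ring
  unfold coeffWeight
  by_cases hδ : δ = 0 <;> by_cases hε : ε = 0
  · simp only [hδ, hε, if_true]
    refine (card_filter_le _ _).trans ?_
    rw [card_product]
    calc _ ≤ n ^ 16 * n ^ 16 := by gcongr
      _ = _ := by ring
  · simp only [hδ, hε, if_true, if_false]
    refine le_trans (card_le_card_of_injOn
      (t := (P ×ˢ P) ×ˢ {p ∈ P ×ˢ P | ε * p.1 = ε * p.2})
      (fun p => ((p.1.1, p.2.1), (p.1.2, p.2.2))) ?_ ?_) ?_
    · rintro ⟨⟨a, b⟩, ⟨c, d⟩⟩ hp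
      simp only [coe_filter, mem_product, Set.mem_ofPred_eq, coe_product, Set.mem_prod,
        zero_mul, zero_add, mem_coe] at hp ⊢
      tauto
    · rintro ⟨⟨a, b⟩, ⟨c, d⟩⟩ _ ⟨⟨a', b'⟩, ⟨c', d'⟩⟩ _ hp
      simp only [Prod.mk.injEq] at hp ⊢
      tauto
    · rw [card_product]
      calc _ ≤ n ^ 16 * n ^ 8 := Nat.mul_le_mul htwo (hone ε hε)
        _ = _ := by ring
  · simp only [hδ, hε, if_true, if_false]
    refine le_trans (card_le_card_of_injOn
      (t := (P ×ˢ P) ×ˢ {p ∈ P ×ˢ P | δ * p.1 = δ * p.2})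
      (fun p => ((p.1.2, p.2.2), (p.1.1, p.2.1))) ?_ ?_) ?_
    · rintro ⟨⟨a, b⟩, ⟨c, d⟩⟩ hp
      simp only [coe_filter, mem_product, Set.mem_ofPred_eq, coe_product, Set.mem_prod,
        zero_mul, add_zero, mem_coe] at hp ⊢
      tauto
    · rintro ⟨⟨a, b⟩, ⟨c, d⟩⟩ _ ⟨⟨a', b'⟩, ⟨c', d'⟩⟩ _ hp
      simp only [Prod.mk.injEq] at hp ⊢
      tauto
    · rw [card_product]
      calc _ ≤ n ^ 16 * n ^ 8 := Nat.mul_le_mul htwo (hone δ hδ)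
        _ = _ := by ring
  · simp only [hδ, hε, if_false]
    have hcs := card_filter_eq_sq_le (P ×ˢ P) (P ×ˢ P) (fun p => δ * p.1 - δ * p.2)
      (fun p => ε * p.1 - ε * p.2)
    have hle : coincidences (P ×ˢ P) (fun p => δ * p.1 + ε * p.2) ≤
        #{p ∈ (P ×ˢ P) ×ˢ (P ×ˢ P) | δ * p.1.1 - δ * p.1.2 = ε * p.2.1 - ε * p.2.2} := by
      refine card_le_card_of_injOn
        (fun p : (ℝ × ℝ) × (ℝ × ℝ) => ((p.1.1, p.2.1), (p.2.2, p.1.2))) ?_ ?_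
      · rintro ⟨⟨a, b⟩, ⟨c, d⟩⟩ hp
        simp only [coe_filter, mem_product, Set.mem_ofPred_eq] at hp ⊢
        exact ⟨by tauto, by linarith [hp.2]⟩
      · rintro ⟨⟨a, b⟩, ⟨c, d⟩⟩ _ ⟨⟨a', b'⟩, ⟨c', d'⟩⟩ _ hp
        simp only [Prod.mk.injEq] at hp ⊢
        tauto
    refine hle.trans ((Nat.pow_le_pow_iff_left two_ne_zero).1 ?_)
    exact hcs.trans ((Nat.mul_le_mul (hcomm δ hδ) (hcomm ε hε)).trans (le_of_eq (by ring)))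

lemma coeffWeight_neg_neg (G n : ℕ) (δ ε : ℝ) :
    coeffWeight G n (-δ) (-ε) = coeffWeight G n δ ε := by
  simp [coeffWeight]

lemma sum_coeffWeight_le (D : Finset ℝ) (hD : (0 : ℝ) ∉ D) (G n : ℕ) :
    ∑ d ∈ insert 0 D ×ˢ insert 0 D, coeffWeight G n d.1 d.2 ≤
      #D ^ 2 * G + 2 * #D * n ^ 12 + n ^ 16 := by
  have hne : ∀ δ ∈ D, δ ≠ 0 := fun δ hδ h => hD (h ▸ hδ)
  have h1 : ∑ ε ∈ D, coeffWeight G n 0 ε = #D * n ^ 12 := by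
    rw [sum_const_nat fun ε hε => ?_]
    simp [coeffWeight, hne ε hε]
  have h2 : ∀ δ ∈ D, ∑ ε ∈ insert 0 D, coeffWeight G n δ ε = n ^ 12 + #D * G := by
    intro δ hδ
    rw [sum_insert hD, sum_const_nat (m := G) fun ε hε => ?_]
    · simp [coeffWeight, hne δ hδ]
    · simp [coeffWeight, hne ε hε, hne δ hδ]
  rw [sum_product, sum_insert hD, sum_insert hD, h1, sum_congr rfl h2, sum_const]
  simp only [coeffWeight, if_true, smul_eq_mul]
  exact le_of_eq (by ring)

open Classical in
lemma card_linear_relation_le (P : Finset ℝ) (G n : ℕ) (hn : #P ≤ n ^ 8)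
    (hG : coincidences (P ×ˢ P) (fun p => p.1 + p.2) ≤ G ^ 2) (d : (ℝ × ℝ) × (ℝ × ℝ)) :
    #{p ∈ (P ×ˢ P) ×ˢ (P ×ˢ P) | d.1.1 * p.1.1 + d.1.2 * p.1.2 =
        (-d.2.1) * p.2.1 + (-d.2.2) * p.2.2} ≤
      coeffWeight G n d.1.1 d.1.2 * coeffWeight G n d.2.1 d.2.2 := by
  refine (Nat.pow_le_pow_iff_left two_ne_zero).1 ?_
  refine (card_filter_eq_sq_le (P ×ˢ P) (P ×ˢ P) (fun p => d.1.1 * p.1 + d.1.2 * p.2)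
    (fun p => (-d.2.1) * p.1 + (-d.2.2) * p.2)).trans ?_
  rw [mul_pow, ← coeffWeight_neg_neg G n d.2.1 d.2.2]
  exact Nat.mul_le_mul (coincidences_linear_le P G n hn hG _ _)
    (coincidences_linear_le P G n hn hG _ _)

lemma coincidences_fourfold_le_of_isBlocking {P : Finset ℝ} {m : ℕ} {β : ℝ → ℕ} {D : Finset ℝ}
    (h : IsBlocking P m β D) (G n : ℕ) (hn : #P ≤ n ^ 8)
    (hG : coincidences (P ×ˢ P) (fun p => p.1 + p.2) ≤ G ^ 2) :
    coincidences ((P ×ˢ P) ×ˢ (P ×ˢ P)) (fun p => p.1.1 + p.1.2 + p.2.1 + p.2.2) ≤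
      (2 * m + 1) ^ 3 * (#D ^ 2 * G + 2 * #D * n ^ 12 + n ^ 16) ^ 2 := by
  classical
  set I := Icc (-(m : ℤ)) m with hI
  refine (coincidences_le_mul_coincidences_prod _ _
    (fun p => ((β p.1.1 : ℤ) - β p.2.2, (β p.1.2 : ℤ) - β p.2.2, (β p.2.1 : ℤ) - β p.2.2))
    (I ×ˢ (I ×ˢ I)) fun p hp => ?_).trans ?_
  · simp only [mem_product] at hp
    have h1 := h.le _ hp.1.1
    have h2 := h.le _ hp.1.2
    have h3 := h.le _ hp.2.1
    have h4 := h.le _ hp.2.2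
    simp only [mem_product, hI, mem_Icc]
    omega
  have hcard : #(I ×ˢ (I ×ˢ I)) = (2 * m + 1) ^ 3 := by
    rw [card_product, card_product, hI, card_Icc_neg]
    ring
  rw [hcard]
  refine Nat.mul_le_mul_left _ ?_
  set D₀ := insert 0 D with hD₀
  have hdiff : ∀ a ∈ P, ∀ a' ∈ P, β a = β a' → ∃ δ ∈ D₀, a + δ * a = a' := by
    intro a ha a' ha' hb
    by_cases hne : a = a'
    · exact ⟨0, mem_insert_self _ _, by simp [hne]⟩
    · obtain ⟨δ, hδ, hd⟩ := h.diff a ha a' ha' hb hne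
      exact ⟨δ, mem_insert_of_mem hδ, by linarith⟩
  have hsub : {p ∈ ((P ×ˢ P) ×ˢ (P ×ˢ P)) ×ˢ ((P ×ˢ P) ×ˢ (P ×ˢ P)) |
      (p.1.1.1 + p.1.1.2 + p.1.2.1 + p.1.2.2,
        ((β p.1.1.1 : ℤ) - β p.1.2.2, (β p.1.1.2 : ℤ) - β p.1.2.2,
          (β p.1.2.1 : ℤ) - β p.1.2.2)) =
      (p.2.1.1 + p.2.1.2 + p.2.2.1 + p.2.2.2,
        ((β p.2.1.1 : ℤ) - β p.2.2.2, (β p.2.1.2 : ℤ) - β p.2.2.2,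
          (β p.2.2.1 : ℤ) - β p.2.2.2))} ⊆
      ((D₀ ×ˢ D₀) ×ˢ (D₀ ×ˢ D₀)).biUnion fun d =>
        ({p ∈ (P ×ˢ P) ×ˢ (P ×ˢ P) | d.1.1 * p.1.1 + d.1.2 * p.1.2 =
          (-d.2.1) * p.2.1 + (-d.2.2) * p.2.2}).image fun p =>
            (p, ((p.1.1 + d.1.1 * p.1.1, p.1.2 + d.1.2 * p.1.2),
              (p.2.1 + d.2.1 * p.2.1, p.2.2 + d.2.2 * p.2.2))) := by
    rintro ⟨⟨⟨a, b⟩, ⟨c, d⟩⟩, ⟨⟨a', b'⟩, ⟨c', d'⟩⟩⟩ hp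
    simp only [mem_filter, mem_product, Prod.mk.injEq] at hp
    obtain ⟨⟨⟨⟨ha, hb⟩, hc, hd⟩, ⟨ha', hb'⟩, hc', hd'⟩, hs, hk1, hk2, hk3⟩ := hp
    have hdd : β d = β d' := by
      rcases lt_trichotomy (β d) (β d') with hlt | heq | hgt
      · have h1 := h.mono.reflect_lt hlt
        have h2 := h.mono.reflect_lt (a := a) (b := a') (by omega)
        have h3 := h.mono.reflect_lt (a := b) (b := b') (by omega)
        have h4 := h.mono.reflect_lt (a := c) (b := c') (by omega)
        linarith
      · exact heq
      · have h1 := h.mono.reflect_lt hgt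
        have h2 := h.mono.reflect_lt (a := a') (b := a) (by omega)
        have h3 := h.mono.reflect_lt (a := b') (b := b) (by omega)
        have h4 := h.mono.reflect_lt (a := c') (b := c) (by omega)
        linarith
    obtain ⟨δ₁, hδ₁, h1⟩ := hdiff a ha a' ha' (by omega)
    obtain ⟨δ₂, hδ₂, h2⟩ := hdiff b hb b' hb' (by omega)
    obtain ⟨δ₃, hδ₃, h3⟩ := hdiff c hc c' hc' (by omega)
    obtain ⟨δ₄, hδ₄, h4⟩ := hdiff d hd d' hd' hdd
    refine mem_biUnion.2 ⟨((δ₁, δ₂), (δ₃, δ₄)), by simp only [mem_product]; tauto,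
      mem_image.2 ⟨((a, b), (c, d)), ?_, ?_⟩⟩
    · simp only [mem_filter, mem_product]
      exact ⟨by tauto, by linarith⟩
    · simp only [h1, h2, h3, h4]
  unfold coincidences
  refine (le_of_eq_of_le (by congr) (card_le_card hsub)).trans (card_biUnion_le.trans ?_)
  calc _ ≤ ∑ d ∈ (D₀ ×ˢ D₀) ×ˢ (D₀ ×ˢ D₀),
        coeffWeight G n d.1.1 d.1.2 * coeffWeight G n d.2.1 d.2.2 :=
        sum_le_sum fun d _ => card_image_le.trans (card_linear_relation_le P G n hn hG d)
    _ = (∑ d ∈ D₀ ×ˢ D₀, coeffWeight G n d.1 d.2) ^ 2 := by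
        rw [sq, sum_mul_sum, sum_product]
    _ ≤ _ := Nat.pow_le_pow_left (sum_coeffWeight_le D h.zero_notMem G n) 2

/-! ### Choice of block lengths -/

open scoped Pointwise in
/-- The fourfold sumset of a set of positive reals with small multiplicative tripling. -/
lemma card_pow_eight_le (P : Finset ℝ) (hP : ∀ a ∈ P, 0 < a) (K n : ℕ) (hn0 : 0 < n)
    (hn : #P ≤ n ^ 8) (hK : #(P * (P / P)) ≤ K * #P) :
    #P ^ 8 ≤ #(P + P + P + P) * ((2 * K + 1) ^ 3 * (40 * K + 25) ^ 2 * n ^ 47) := by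
  have hW : #(P * (P / P)) ≤ K * n ^ 8 := hK.trans (Nat.mul_le_mul_left _ hn)
  have hdiv : ∀ i j : ℕ, i + j = 8 → 2 * (#(P * (P / P)) / n ^ i) + 1 ≤ (2 * K + 1) * n ^ j := by
    intro i j hij
    have h1 : #(P * (P / P)) / n ^ i ≤ K * n ^ j := by
      refine Nat.div_le_of_le_mul (hW.trans (le_of_eq ?_))
      rw [← hij]
      ring
    have h2 : 1 ≤ n ^ j := Nat.one_le_pow _ _ hn0
    linarith
  -- With n⁸ in the role of N, block length n⁴ balances the diagonal term N² against N·|D|².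
  obtain ⟨β, D, hD, hb⟩ := exists_isBlocking P hP (n ^ 4) (by positivity)
  have hG : coincidences (P ×ˢ P) (fun p => p.1 + p.2) ≤ (5 * (2 * K + 1) * n ^ 10) ^ 2 := by
    refine (coincidences_add_le_of_isBlocking hb).trans ?_
    calc _ ≤ ((2 * K + 1) * n ^ 4) * ((n ^ 8) ^ 2 + n ^ 8 * (2 * n ^ 4) ^ 2) := by
          gcongr
          exact hdiv 4 4 rfl
      _ = (5 * (2 * K + 1) * n ^ 20) * 1 := by ring
      _ ≤ (5 * (2 * K + 1) * n ^ 20) * (5 * (2 * K + 1)) := by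
          gcongr
          omega
      _ = _ := by ring
  -- Length n³ balances the main term |D|²G, with G of order n¹⁰, against n¹⁶ from all-zero
  -- coefficients.
  obtain ⟨β, D, hD, hb⟩ := exists_isBlocking P hP (n ^ 3) (by positivity)
  have hT := coincidences_fourfold_le_of_isBlocking hb _ n hn hG
  have hT' : coincidences ((P ×ˢ P) ×ˢ (P ×ˢ P)) (fun p => p.1.1 + p.1.2 + p.2.1 + p.2.2) ≤
      (2 * K + 1) ^ 3 * (40 * K + 25) ^ 2 * n ^ 47 := by
    refine hT.trans ?_
    have h12 : n ^ 12 ≤ n ^ 13 := Nat.pow_le_pow_right hn0 (by norm_num)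
    calc _ ≤ ((2 * K + 1) * n ^ 5) ^ 3 * ((2 * n ^ 3) ^ 2 * (5 * (2 * K + 1) * n ^ 10) +
            2 * (2 * n ^ 3) * n ^ 13 + n ^ 16) ^ 2 := by
          gcongr
          exact hdiv 3 5 rfl
      _ = _ := by ring
  have hcs := card_sq_le_mul_coincidences ((P ×ˢ P) ×ˢ (P ×ˢ P))
    (fun p => p.1.1 + p.1.2 + p.2.1 + p.2.2) (P + P + P + P) fun p hp => by
      simp only [mem_product] at hp
      exact add_mem_add (add_mem_add (add_mem_add hp.1.1 hp.1.2) hp.2.1) hp.2.2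
  calc #P ^ 8 = #((P ×ˢ P) ×ˢ (P ×ˢ P)) ^ 2 := by
        simp only [card_product]
        ring
    _ ≤ _ := hcs.trans (Nat.mul_le_mul_left _ hT')

/-! ### Reduction to positive sets with small tripling -/

-- Logarithms turn this into the additive Plünnecke–Ruzsa inequality for 2B − B, whence the exponent
-- 2 + 1 = 3.
open scoped Pointwise in
lemma card_mul_div_le (P : Finset ℝ) (hP : ∀ a ∈ P, 0 < a) (hne : P.Nonempty) (K : ℝ)
    (hK : (#(P / P) : ℝ) ≤ K * #P) : (#(P * (P / P)) : ℝ) ≤ K ^ 3 * #P := by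
  classical
  set B := P.image Real.log with hB
  have hBP : #B = #P := card_image_of_injOn fun a ha b hb hab =>
    Real.log_injOn_pos (hP a ha) (hP b hb) hab
  have hN : (0 : ℝ) < #P := by exact_mod_cast hne.card_pos
  have h1 : #(B - B) ≤ #(P / P) := by
    refine (card_le_card (t := (P / P).image Real.log) fun x hx => ?_).trans card_image_le
    obtain ⟨_, hy, _, hz, rfl⟩ := mem_sub.1 hx
    obtain ⟨a, ha, rfl⟩ := mem_image.1 hy
    obtain ⟨b, hb, rfl⟩ := mem_image.1 hz
    exact mem_image.2 ⟨a / b, div_mem_div ha hb,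
      Real.log_div (hP a ha).ne' (hP b hb).ne'⟩
  have h2 : #(P * (P / P)) ≤ #(2 • B - 1 • B) := by
    refine (card_le_card (t := (2 • B - 1 • B).image Real.exp) fun x hx => ?_).trans
      card_image_le
    obtain ⟨a, ha, _, hy, rfl⟩ := mem_mul.1 hx
    obtain ⟨b, hb, c, hc, rfl⟩ := mem_div.1 hy
    refine mem_image.2 ⟨Real.log a + Real.log b - Real.log c, ?_, ?_⟩
    · rw [two_nsmul, one_nsmul]
      exact sub_mem_sub (add_mem_add (mem_image_of_mem _ ha) (mem_image_of_mem _ hb))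
        (mem_image_of_mem _ hc)
    · rw [Real.exp_sub, Real.exp_add, Real.exp_log (hP a ha), Real.exp_log (hP b hb),
        Real.exp_log (hP c hc), mul_div_assoc]
  have h3 := pluennecke_ruzsa_inequality_nsmul_sub_nsmul_sub (hne.image Real.log) B 2 1
  have h4 : (#(2 • B - 1 • B) : ℝ) ≤ ((#(B - B) : ℝ) / #B) ^ 3 * #B := by
    have h := (NNRat.cast_le (K := ℝ)).2 h3
    push_cast at h
    exact h
  have h5 : (#(B - B) : ℝ) / #B ≤ K := by
    rw [hBP, div_le_iff₀ hN]
    exact le_trans (by exact_mod_cast h1) hK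
  calc (#(P * (P / P)) : ℝ) ≤ #(2 • B - 1 • B) := by exact_mod_cast h2
    _ ≤ ((#(B - B) : ℝ) / #B) ^ 3 * #B := h4
    _ ≤ K ^ 3 * #P := by
        rw [← hBP]
        gcongr

open scoped Pointwise in
/-- A set of reals has a large set of positive elements up to sign, whose fourfold sumset and
quotient set are no larger. -/
lemma exists_pos_subset (A : Finset ℝ) (hA : 2 ≤ #A) :
    ∃ P : Finset ℝ, (∀ a ∈ P, 0 < a) ∧ #P ≤ #A ∧ #A ≤ 4 * #P ∧
      #(P / P) ≤ #(quotientSet A A) ∧ #(P + P + P + P) ≤ #(A + A + A + A) := by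
  classical
  have hsub : A ⊆ {a ∈ A | 0 < a} ∪ {a ∈ A | a < 0} ∪ {0} := by
    intro a ha
    simp only [mem_union, mem_filter, mem_singleton]
    rcases lt_trichotomy a 0 with h | h | h <;> tauto
  have hcard : #A ≤ #{a ∈ A | 0 < a} + #{a ∈ A | a < 0} + 1 :=
    (card_le_card hsub).trans ((card_union_le _ _).trans
      (add_le_add (card_union_le _ _) (card_singleton _).le))
  have hquot : ∀ S ⊆ A, (∀ a ∈ S, a ≠ 0) → S / S ⊆ quotientSet A A := by
    intro S hS h0 x hx
    obtain ⟨a, ha, b, hb, rfl⟩ := mem_div.1 hx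
    exact mem_image₂.2 ⟨a, hS ha, b, mem_filter.2 ⟨hS hb, h0 b hb⟩, rfl⟩
  have hsum : ∀ S ⊆ A, S + S + S + S ⊆ A + A + A + A := fun S hS =>
    add_subset_add (add_subset_add (add_subset_add hS hS) hS) hS
  rcases le_total #{a ∈ A | a < 0} #{a ∈ A | 0 < a} with h | h
  · refine ⟨{a ∈ A | 0 < a}, fun a ha => (mem_filter.1 ha).2, card_le_card (filter_subset _ _),
      by omega, card_le_card (hquot _ (filter_subset _ _) fun a ha => (mem_filter.1 ha).2.ne'),
      card_le_card (hsum _ (filter_subset _ _))⟩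
  · set S := {a ∈ A | a < 0} with hS
    have hSA : S ⊆ A := filter_subset _ _
    have hneg : #(-S) = #S := card_neg S
    refine ⟨-S, fun a ha => ?_, hneg ▸ card_le_card hSA, by omega, ?_, ?_⟩
    · have := (mem_filter.1 (mem_neg'.1 ha)).2
      linarith
    · refine card_le_card (subset_trans ?_ (hquot S hSA fun a ha => (mem_filter.1 ha).2.ne))
      intro x hx
      obtain ⟨a, ha, b, hb, rfl⟩ := mem_div.1 hx
      rw [← neg_div_neg_eq a b]
      exact div_mem_div (mem_neg'.1 ha) (mem_neg'.1 hb)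
    · have : -S + -S + -S + -S = -(S + S + S + S) := by simp only [neg_add]
      rw [this, card_neg]
      exact card_le_card (hsum S hSA)

end SumsetGrowth

theorem mainTheorem5 :
    ∃ c : ℝ, 0 < c ∧ ∃ p : ℝ, 0 < p ∧
      ∀ M : ℝ, ∃ C : ℝ, 0 < C ∧
        ∀ A : Finset ℝ, 2 ≤ A.card →
          ((quotientSet A A).card : ℝ) ≤ M * (A.card : ℝ) →
          (A.card : ℝ) ^ (2 + c) ≤
            C * ((A + A + A + A).card : ℝ) * (Real.logb 2 (A.card : ℝ)) ^ p := by
  refine ⟨1 / 8, by norm_num, 1, one_pos, fun M => ?_⟩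
  set K : ℕ := ⌈(4 * |M|) ^ 3⌉₊ with hK
  set R : ℕ := (2 * K + 1) ^ 3 * (40 * K + 25) ^ 2 with hR
  -- The 4⁸ pays for |A| ≤ 4|P|, and 2⁴⁷ for rounding |A|^{1/8} up to the integer n.
  refine ⟨4 ^ 8 * (R * 2 ^ 47), by positivity, fun A hA hM => ?_⟩
  obtain ⟨P, hP, hPA, hAP, hquot, hsum⟩ := SumsetGrowth.exists_pos_subset A hA
  have hAR : (2 : ℝ) ≤ A.card := by exact_mod_cast hA
  have hA0 : (0 : ℝ) < A.card := by linarith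
  have hAPR : (A.card : ℝ) ≤ 4 * P.card := by exact_mod_cast hAP
  have hPne : P.Nonempty := Finset.card_pos.1 (by omega)
  have hPquot : ((P / P).card : ℝ) ≤ (4 * |M|) * P.card :=
    calc ((P / P).card : ℝ) ≤ (quotientSet A A).card := by exact_mod_cast hquot
      _ ≤ M * A.card := hM
      _ ≤ |M| * A.card := by gcongr; exact le_abs_self M
      _ ≤ |M| * (4 * P.card) := by gcongr
      _ = _ := by ring
  have hPK : (P * (P / P)).card ≤ K * P.card := by
    have h := (SumsetGrowth.card_mul_div_le P hP hPne _ hPquot).trans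
      (mul_le_mul_of_nonneg_right (Nat.le_ceil _) (Nat.cast_nonneg _))
    exact_mod_cast h
  set y : ℝ := (A.card : ℝ) ^ (1 / 8 : ℝ) with hy
  have hy1 : 1 ≤ y := Real.one_le_rpow (by linarith) (by norm_num)
  have hy8 : y ^ 8 = A.card := by
    rw [hy, ← Real.rpow_natCast, ← Real.rpow_mul hA0.le]
    norm_num
  set n : ℕ := ⌈y⌉₊ with hn
  have hyn : y ≤ n := Nat.le_ceil y
  have hny : (n : ℝ) ≤ 2 * y := by linarith [Nat.ceil_lt_add_one (zero_le_one.trans hy1)]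
  have hn0 : 0 < n := Nat.ceil_pos.2 (by linarith)
  have hPn : P.card ≤ n ^ 8 := by
    refine hPA.trans ?_
    have : (A.card : ℝ) ≤ (n : ℝ) ^ 8 := by
      rw [← hy8]
      gcongr
    exact_mod_cast this
  have hmain : (P.card : ℝ) ^ 8 ≤ (P + P + P + P).card * (R * (n : ℝ) ^ 47) := by
    exact_mod_cast SumsetGrowth.card_pow_eight_le P hP K n hn0 hPn hPK
  have hlhs : (A.card : ℝ) ^ (2 + 1 / 8 : ℝ) = y ^ 17 := by
    rw [hy, ← Real.rpow_natCast, ← Real.rpow_mul hA0.le]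
    norm_num
  have hlog : 1 ≤ Real.logb 2 (A.card : ℝ) := by
    rw [Real.le_logb_iff_rpow_le one_lt_two hA0]
    simpa using hAR
  have hprod : y ^ 17 * y ^ 47 ≤
      4 ^ 8 * (R * 2 ^ 47) * ((A + A + A + A).card : ℝ) * y ^ 47 :=
    calc y ^ 17 * y ^ 47 = (A.card : ℝ) ^ 8 := by rw [← hy8]; ring
      _ ≤ (4 * (P.card : ℝ)) ^ 8 := by gcongr
      _ = 4 ^ 8 * (P.card : ℝ) ^ 8 := by ring
      _ ≤ 4 ^ 8 * ((P + P + P + P).card * (R * (n : ℝ) ^ 47)) := by gcongr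
      _ ≤ 4 ^ 8 * ((A + A + A + A).card * (R * (2 * y) ^ 47)) := by gcongr
      _ = _ := by ring
  rw [hlhs, Real.rpow_one]
  calc y ^ 17 ≤ 4 ^ 8 * (R * 2 ^ 47) * ((A + A + A + A).card : ℝ) :=
        le_of_mul_le_mul_right hprod (by positivity)
    _ ≤ _ := le_mul_of_one_le_right (by positivity) hlog
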